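/- For $s>0$ let $$\xi_0(s)=2\,{}_2F_1(1,s;s+1;-1)-1,$$ where ${}_2F_1$ is the Gauss hypergeometric function, given for real $0<b<c$ and $z<1$ by Euler's integral $${}_2F_1(a,b;c;z)=\frac{\Gamma(c)}{\Gamma(b)\Gamma(c-b)}\int_0^1\frac{x^{b-1}(1-x)^{c-b-1}}{(1-zx)^a}\,dx ,$$ and let $$\xi_1(s)=\frac{1-\xi_0(s)}{2s},\qquad \xi_2(s)=2s\,\xi_0(s),\qquad \xi_3(s)=\frac{1-\xi_0(s)}{2s\,\xi_0(s)} .$$ The functions $\xi_0,\xi_1,\xi_2,\xi_3$ are continuous on $(0,\infty)$. Moreover: (i) $\xi_0$ is strictly decreasing and maps $(0,\infty)$ onto $(0,1)$; it is differentiable on $(0,\infty)$, and the function $s\mapsto s^2\xi_0'(s)$ is strictly decreasing on $(0,\infty)$. (ii) $\xi_1$ is strictly decreasing and maps $(0,\infty)$ onto $(0,\ln 2)$. (iii) $\xi_2$ is strictly increasing and maps $(0,\infty)$ onto $(0,1)$. (iv) $\xi_3$ is strictly increasing and maps $(0,\infty)$ onto $(\ln 2,1)$. Consequently these functions extend by continuity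 to $0$ and to $\infty$: as $s\to0^+$ the limits of $\xi_0,\xi_1,\xi_2,\xi_3$ are $1,\ \ln 2,\ 0,\ \ln 2$ respectively, and as $s\to\infty$ they are $0,\ 0,\ 1,\ 1$ respectively. -/

import Mathlib

open Set Filter Topology

noncomputable section

/-- The real Gauss hypergeometric function `₂F₁(a, b; c; z)` for `0 < b < c` and `z < 1`, given by
Euler's integral. For `|z| < 1` it is the sum of Gauss's power series; the integral continues it
to all real `z < 1`, in particular to `z = -1`. (The constant `ordinaryHypergeometric` cannot be
used at `z = -1`: it is an unconditional sum, hence takes a junk value where the series converges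
only conditionally.) See `tendsto_gauss_series` for the comparison with the series. -/
def gaussHypergeometric (a b c z : ℝ) : ℝ :=
  Real.Gamma c / (Real.Gamma b * Real.Gamma (c - b)) *
    ∫ x in (0 : ℝ)..1, x ^ (b - 1) * (1 - x) ^ (c - b - 1) / (1 - z * x) ^ a

/-- `ξ₀(s) = 2 ₂F₁(1, s; s + 1; -1) - 1`. -/
def xi0 (s : ℝ) : ℝ := 2 * gaussHypergeometric 1 s (s + 1) (-1) - 1

/-- `ξ₁(s) = (1 - ξ₀(s)) / (2 s)`. -/
def xi1 (s : ℝ) : ℝ := (1 - xi0 s) / (2 * s)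

/-- `ξ₂(s) = 2 s ξ₀(s)`. -/
def xi2 (s : ℝ) : ℝ := 2 * s * xi0 s

/-- `ξ₃(s) = (1 - ξ₀(s)) / (2 s ξ₀(s))`. -/
def xi3 (s : ℝ) : ℝ := (1 - xi0 s) / (2 * s * xi0 s)

theorem gaussHypergeometric_one_self_add_one {s : ℝ} (hs : 0 < s) (z : ℝ) :
    gaussHypergeometric 1 s (s + 1) z = s * ∫ x in (0 : ℝ)..1, x ^ (s - 1) / (1 - z * x) := by
  have h : s + 1 - s = 1 := by ring
  have hG : Real.Gamma s ≠ 0 := (Real.Gamma_pos_of_pos hs).ne'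
  simp only [gaussHypergeometric, h, Real.Gamma_one, mul_one, sub_self, Real.rpow_zero,
    Real.rpow_one, Real.Gamma_add_one hs.ne']
  rw [mul_div_assoc, div_self hG, mul_one]

/-- Gauss's series `∑ (1)ₙ (s)ₙ / ((s+1)ₙ n!) zⁿ` converges to `₂F₁(1, s; s+1; z)`, for every real
`z` with `-1 ≤ z < 1`, the value `z = -1` included. -/
theorem tendsto_gauss_series {s z : ℝ} (hs : 0 < s) (hz : -1 ≤ z) (hz' : z < 1) :
    Tendsto (fun N : ℕ => ∑ n ∈ Finset.range N,
        ordinaryHypergeometricCoefficient 1 s (s + 1) n * z ^ n) atTop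
      (𝓝 (gaussHypergeometric 1 s (s + 1) z)) := by
  have hc : ∀ n : ℕ, ordinaryHypergeometricCoefficient 1 s (s + 1) n = s / (s + n) := by
    intro n
    have hP : ∀ t : ℝ, 0 < t → 0 < (ascPochhammer ℝ n).eval t := fun t ht =>
      ascPochhammer_pos n t ht
    have h1 : (ascPochhammer ℝ n).eval 1 = (n.factorial : ℝ) := ascPochhammer_eval_one ℝ n
    have h2 : s * (ascPochhammer ℝ n).eval (s + 1) = (ascPochhammer ℝ n).eval s * (s + n) := by
      rw [← ascPochhammer_succ_eval, ascPochhammer_succ_left]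
      simp [Polynomial.eval_comp]
    have h3 := hP (s + 1) (by linarith)
    have h4 : (n.factorial : ℝ) ≠ 0 := by positivity
    have h5 : s + n ≠ 0 := by positivity
    have h6 := h3.ne'
    simp only [ordinaryHypergeometricCoefficient, h1]
    field_simp
    linarith
  have hint : ∀ n : ℕ, ∫ x in (0 : ℝ)..1, x ^ (s - 1 + n) = 1 / (s + n) := by
    intro n
    have hn : (0 : ℝ) ≤ n := n.cast_nonneg
    rw [integral_rpow (Or.inl (by linarith))]
    rw [Real.zero_rpow (by linarith), Real.one_rpow]
    congr 1 <;> ring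
  have hII : ∀ n : ℕ, IntervalIntegrable (fun x : ℝ => x ^ (s - 1 + n)) MeasureTheory.volume 0 1 :=
    fun n => by
      have hn : (0 : ℝ) ≤ n := n.cast_nonneg
      exact intervalIntegral.intervalIntegrable_rpow' (by linarith)
  have hI0 : IntervalIntegrable (fun x : ℝ => x ^ (s - 1)) MeasureTheory.volume 0 1 := by
    simpa using hII 0
  have hden : ∀ x ∈ Icc (0 : ℝ) 1, min 1 (1 - z) ≤ 1 - z * x := by
    rintro x ⟨h0, h1⟩
    rcases le_total z 0 with h | h
    · exact (min_le_left _ _).trans (by nlinarith)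
    · exact (min_le_right _ _).trans (by nlinarith)
  have hm : 0 < min 1 (1 - z) := lt_min one_pos (by linarith)
  set m := min 1 (1 - z) with hmdef
  have hcont : ContinuousOn (fun x : ℝ => (1 - z * x)⁻¹) (uIcc 0 1) := by
    rw [uIcc_of_le zero_le_one]
    exact ContinuousOn.inv₀ (by fun_prop) fun x hx => (hm.trans_le (hden x hx)).ne'
  have hIq : ∀ n : ℕ, IntervalIntegrable (fun x : ℝ => x ^ (s - 1 + n) / (1 - z * x))
      MeasureTheory.volume 0 1 := fun n => by
    simpa [div_eq_mul_inv] using (hII n).mul_continuousOn hcont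
  have hpart : ∀ N : ℕ, gaussHypergeometric 1 s (s + 1) z
      - ∑ n ∈ Finset.range N, ordinaryHypergeometricCoefficient 1 s (s + 1) n * z ^ n
      = s * z ^ N * ∫ x in (0 : ℝ)..1, x ^ (s - 1 + N) / (1 - z * x) := by
    intro N
    induction N with
    | zero => simp [gaussHypergeometric_one_self_add_one hs]
    | succ N ih =>
      rw [Finset.sum_range_succ, ← sub_sub, ih, hc]
      have hstep : (∫ x in (0 : ℝ)..1, x ^ (s - 1 + N) / (1 - z * x)) =
          1 / (s + N) + z * ∫ x in (0 : ℝ)..1, x ^ (s - 1 + (N + 1 : ℕ)) / (1 - z * x) := by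
        rw [← hint N, ← intervalIntegral.integral_const_mul,
          ← intervalIntegral.integral_add (hII N) ((hIq (N + 1)).const_mul z)]
        refine intervalIntegral.integral_congr_ae (Eventually.of_forall fun x hx => ?_)
        rw [uIoc_of_le zero_le_one] at hx
        have hx' : 1 - z * x ≠ 0 := (hm.trans_le (hden x ⟨hx.1.le, hx.2⟩)).ne'
        have hpow : x ^ (s - 1 + (N + 1 : ℕ)) = x ^ (s - 1 + N) * x := by
          rw [← Real.rpow_add_one hx.1.ne']
          push_cast
          ring_nf
        rw [hpow]
        field_simp
        ring
      rw [hstep]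
      ring
  have hbound : ∀ N : ℕ, ‖s * z ^ N * ∫ x in (0 : ℝ)..1, x ^ (s - 1 + N) / (1 - z * x)‖
      ≤ s / m * (1 / (s + N)) := by
    intro N
    have hz1 : |z| ^ N ≤ 1 := pow_le_one₀ (abs_nonneg _) (abs_le.2 ⟨hz, hz'.le⟩)
    have hJ : (∫ x in (0 : ℝ)..1, x ^ (s - 1 + N) / (1 - z * x)) ≤ (1 / (s + N)) / m := by
      rw [← hint N, ← intervalIntegral.integral_div]
      refine intervalIntegral.integral_mono_on zero_le_one (hIq N) ((hII N).div_const m) ?_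
      intro x hx
      exact div_le_div_of_nonneg_left (Real.rpow_nonneg hx.1 _) hm (hden x hx)
    have hJ0 : 0 ≤ ∫ x in (0 : ℝ)..1, x ^ (s - 1 + N) / (1 - z * x) :=
      intervalIntegral.integral_nonneg zero_le_one fun x hx =>
        div_nonneg (Real.rpow_nonneg hx.1 _) (hm.le.trans (hden x hx))
    rw [Real.norm_eq_abs, abs_mul, abs_mul, abs_pow, abs_of_pos hs, abs_of_nonneg hJ0]
    calc s * |z| ^ N * _ ≤ s * 1 * ((1 / (s + N)) / m) := by gcongr
      _ = _ := by ring
  have hlim : Tendsto (fun N : ℕ => s / m * (1 / (s + N))) atTop (𝓝 0) := by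
    have : Tendsto (fun N : ℕ => s + (N : ℝ)) atTop atTop :=
      tendsto_atTop_add_const_left _ _ tendsto_natCast_atTop_atTop
    simpa using (this.inv_tendsto_atTop).const_mul (s / m)
  have h0 := squeeze_zero_norm hbound hlim
  have := h0.const_sub (gaussHypergeometric 1 s (s + 1) z)
  rw [sub_zero] at this
  refine this.congr fun N => ?_
  rw [← hpart N]
  ring

end

/-! ### Ranges of monotone functions and strict comparison of integrals -/

open MeasureTheory intervalIntegral

/-! Substituting y = x^s in Euler's integral gives ξ₀(s) = 2H(1/s) - 1 with H(w) = ∫₀¹ dy/(1 + y^w).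
Here H(0) = 1/2, H' > 0, and H' is strictly decreasing on [0, ∞). Hence ξ₀ decreases, s²ξ₀'(s) =
-2H'(1/s) decreases, and ξ₂(s), which is 4 times the slope of the secant of H from 0 to 1/s,
increases by strict concavity towards 4H'(0) = 1.

The other two functions use ξ₁(s) = ∫₀¹ x^s/(1 + x) dx (`xi1_eq_integral`) and ξ₀(s) = 2∫₀¹ x^s/(1 +
x)² dx (`xi0_eq_integral_sq`). The first is visibly decreasing. The quotient 2ξ₃ = 2ξ₁/ξ₀ is the
mean of 1 + x for the weight x^s/(1 + x)²; raising s moves mass to the right, so it increases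
(`strictMonoOn_xi3`).

Each range then follows from continuity, strict monotonicity and the two end limits. -/

theorem StrictMonoOn.image_Ioi_eq_Ioo {f : ℝ → ℝ} {a b c : ℝ} (hf : StrictMonoOn f (Ioi c))
    (hc : ContinuousOn f (Ioi c)) (ha : Tendsto f (𝓝[>] c) (𝓝 a)) (hb : Tendsto f atTop (𝓝 b)) :
    f '' Ioi c = Ioo a b := by
  have hle : ∀ x ∈ Ioi c, a ≤ f x := fun x hx => le_of_tendsto ha <| by
    filter_upwards [Ioo_mem_nhdsGT hx] with y hy using (hf hy.1 hx hy.2).le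
  have hge : ∀ x ∈ Ioi c, f x ≤ b := fun x hx => ge_of_tendsto hb <| by
    filter_upwards [Ioi_mem_atTop x] with y hy using (hf hx (mem_Ioi.2 (lt_trans hx hy)) hy).le
  apply Subset.antisymm
  · rintro _ ⟨x, hx, rfl⟩
    obtain ⟨y, hcy, hyx⟩ := exists_between (mem_Ioi.1 hx)
    have hx1 : x < x + 1 := by linarith
    exact ⟨(hle y hcy).trans_lt (hf hcy hx hyx),
      (hf hx (lt_trans hx hx1) hx1).trans_le (hge _ (lt_trans hx hx1))⟩
  · rintro v ⟨hav, hvb⟩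
    obtain ⟨x, hxv, hx⟩ := ((ha.eventually_lt_const hav).and self_mem_nhdsWithin).exists
    obtain ⟨y, hyv, hy⟩ := ((hb.eventually_const_lt hvb).and (Ioi_mem_atTop c)).exists
    exact isPreconnected_Ioi.intermediate_value hx hy hc ⟨hxv.le, hyv.le⟩

theorem StrictAntiOn.image_Ioi_eq_Ioo {f : ℝ → ℝ} {a b c : ℝ} (hf : StrictAntiOn f (Ioi c))
    (hc : ContinuousOn f (Ioi c)) (ha : Tendsto f (𝓝[>] c) (𝓝 a)) (hb : Tendsto f atTop (𝓝 b)) :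
    f '' Ioi c = Ioo b a := by
  have h := StrictMonoOn.image_Ioi_eq_Ioo (f := fun x => -f x) (fun x hx y hy hxy =>
    neg_lt_neg (hf hx hy hxy)) hc.neg ha.neg hb.neg
  ext v
  have hv := Set.ext_iff.1 h (-v)
  simp only [mem_image, neg_inj, mem_Ioo, neg_lt_neg_iff] at hv ⊢
  rw [hv, and_comm]

theorem intervalIntegral_lt_of_forall_Ioo_lt {f g : ℝ → ℝ} {a b : ℝ}
    (hf : IntervalIntegrable f volume a b) (hg : IntervalIntegrable g volume a b) (hab : a < b)
    (h : ∀ x ∈ Ioo a b, f x < g x) : ∫ x in a..b, f x < ∫ x in a..b, g x := by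
  have := intervalIntegral_pos_of_pos_on (hg.sub hf) (fun x hx => sub_pos.2 (h x hx)) hab
  rwa [integral_sub hg hf, sub_pos] at this

/-! ### The function H and its strict concavity -/

/-- The function `H` with `₂F₁(1, s; s + 1; -1) = H (1 / s)`. -/
noncomputable def recipHypergeometric (w : ℝ) : ℝ := ∫ y in (0 : ℝ)..1, (1 + y ^ w)⁻¹

/-- The derivative of `recipHypergeometric`. -/
noncomputable def recipHypergeometricDeriv (w : ℝ) : ℝ :=
  ∫ y in (0 : ℝ)..1, -(y ^ w * Real.log y) / (1 + y ^ w) ^ 2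

/-- Differentiation under the integral sign: p ≤ (1 + p)² for p = y^v bounds the derivative by |log
y|, integrable and independent of v. -/
theorem intervalIntegrable_and_hasDerivAt_recipHypergeometric (w : ℝ) :
    IntervalIntegrable (fun y : ℝ => -(y ^ w * Real.log y) / (1 + y ^ w) ^ 2) volume 0 1 ∧
      HasDerivAt recipHypergeometric (recipHypergeometricDeriv w) w := by
  have hmeas (v : ℝ) : Measurable fun y : ℝ => (1 + y ^ v)⁻¹ := by fun_prop
  have hmeas' : Measurable fun y : ℝ => -(y ^ w * Real.log y) / (1 + y ^ w) ^ 2 := by fun_prop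
  have hFint : IntervalIntegrable (fun y : ℝ => (1 + y ^ w)⁻¹) volume 0 1 := by
    refine (intervalIntegrable_const (c := (1 : ℝ))).mono_fun (hmeas w).aestronglyMeasurable ?_
    refine (ae_restrict_mem measurableSet_uIoc).mono fun y hy => ?_
    rw [uIoc_of_le zero_le_one] at hy
    have := Real.rpow_pos_of_pos hy.1 w
    beta_reduce
    rw [norm_one, Real.norm_of_nonneg (by positivity)]
    exact inv_le_one_of_one_le₀ (le_add_of_nonneg_right this.le)
  refine hasDerivAt_integral_of_dominated_loc_of_deriv_le (s := univ)
    (F' := fun v y => -(y ^ v * Real.log y) / (1 + y ^ v) ^ 2) (bound := fun y => |Real.log y|)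
    univ_mem (Eventually.of_forall fun v => (hmeas v).aestronglyMeasurable) hFint
    hmeas'.aestronglyMeasurable ?_ intervalIntegrable_log'.abs ?_
  · refine Eventually.of_forall fun y hy v _ => ?_
    rw [uIoc_of_le zero_le_one] at hy
    have hp := Real.rpow_pos_of_pos hy.1 v
    rw [norm_div, norm_neg, norm_mul, Real.norm_of_nonneg hp.le,
      Real.norm_of_nonneg (by positivity : 0 ≤ (1 + y ^ v) ^ 2), Real.norm_eq_abs,
      div_le_iff₀ (by positivity), mul_comm]
    exact mul_le_mul_of_nonneg_left (by nlinarith) (abs_nonneg _)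
  · refine Eventually.of_forall fun y hy v _ => ?_
    rw [uIoc_of_le zero_le_one] at hy
    have hp := Real.rpow_pos_of_pos hy.1 v
    exact ((Real.hasStrictDerivAt_const_rpow hy.1 v).hasDerivAt.const_add 1).inv (by positivity)

theorem hasDerivAt_recipHypergeometric (w : ℝ) :
    HasDerivAt recipHypergeometric (recipHypergeometricDeriv w) w :=
  (intervalIntegrable_and_hasDerivAt_recipHypergeometric w).2

theorem continuous_recipHypergeometric : Continuous recipHypergeometric :=
  continuous_iff_continuousAt.2 fun w => (hasDerivAt_recipHypergeometric w).continuousAt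

theorem recipHypergeometric_zero : recipHypergeometric 0 = 1 / 2 := by
  norm_num [recipHypergeometric]

theorem recipHypergeometricDeriv_zero : recipHypergeometricDeriv 0 = 1 / 4 := by
  norm_num [recipHypergeometricDeriv, intervalIntegral.integral_neg,
    intervalIntegral.integral_div]

theorem recipHypergeometricDeriv_pos (w : ℝ) : 0 < recipHypergeometricDeriv w := by
  refine intervalIntegral_pos_of_pos_on
    (intervalIntegrable_and_hasDerivAt_recipHypergeometric w).1 (fun y hy => ?_) one_pos
  have hp := Real.rpow_pos_of_pos hy.1 w
  have hl := Real.log_neg hy.1 hy.2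
  exact div_pos (by nlinarith) (by positivity)

/-- For 0 < y < 1 the integrand is -log y > 0 times p/(1 + p)² at p = y^w. The latter increases in p
on (0, 1], and p ≤ 1 exactly because w ≥ 0. -/
theorem strictAntiOn_recipHypergeometricDeriv : StrictAntiOn recipHypergeometricDeriv (Ici 0) := by
  intro v hv w hw hvw
  refine intervalIntegral_lt_of_forall_Ioo_lt
    (intervalIntegrable_and_hasDerivAt_recipHypergeometric w).1
    (intervalIntegrable_and_hasDerivAt_recipHypergeometric v).1 one_pos fun y hy => ?_
  have hq := Real.rpow_pos_of_pos hy.1 w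
  have hqp : y ^ w < y ^ v := Real.rpow_lt_rpow_of_exponent_gt hy.1 hy.2 hvw
  have hp1 : y ^ v ≤ 1 := Real.rpow_le_one hy.1.le hy.2.le hv
  have hl := Real.log_neg hy.1 hy.2
  generalize y ^ w = q at *
  generalize y ^ v = p at *
  have hp : 0 < p := hq.trans hqp
  have key : q / (1 + q) ^ 2 < p / (1 + p) ^ 2 := by
    rw [div_lt_div_iff₀ (by positivity) (by positivity)]
    -- The cross-multiplied difference is p(1 + q)² - q(1 + p)² = (p - q)(1 - pq).
    nlinarith [mul_pos (sub_pos.2 hqp) (show 0 < 1 - p * q by nlinarith)]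
  calc -(q * Real.log y) / (1 + q) ^ 2 = q / (1 + q) ^ 2 * -Real.log y := by ring
    _ < p / (1 + p) ^ 2 * -Real.log y := mul_lt_mul_of_pos_right key (by linarith)
    _ = _ := by ring

theorem strictMono_recipHypergeometric : StrictMono recipHypergeometric :=
  strictMono_of_deriv_pos fun w => by
    rw [(hasDerivAt_recipHypergeometric w).deriv]
    exact recipHypergeometricDeriv_pos w

theorem strictConcaveOn_recipHypergeometric : StrictConcaveOn ℝ (Ici 0) recipHypergeometric := by
  refine StrictAntiOn.strictConcaveOn_of_deriv (convex_Ici 0)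
    continuous_recipHypergeometric.continuousOn ?_
  have : deriv recipHypergeometric = recipHypergeometricDeriv :=
    funext fun w => (hasDerivAt_recipHypergeometric w).deriv
  rw [this]
  exact strictAntiOn_recipHypergeometricDeriv.mono interior_subset

/-! ### Integral representations -/

theorem xi0_eq_integral {s : ℝ} (hs : 0 < s) :
    xi0 s = 2 * (s * ∫ x in (0 : ℝ)..1, x ^ (s - 1) / (1 + x)) - 1 := by
  rw [xi0, gaussHypergeometric_one_self_add_one hs]
  simp only [neg_mul, one_mul, sub_neg_eq_add]

theorem continuousOn_inv_one_add_pow (n : ℕ) :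
    ContinuousOn (fun x : ℝ => ((1 + x) ^ n)⁻¹) (Icc 0 1) :=
  ContinuousOn.inv₀ (by fun_prop) fun x hx => pow_ne_zero _ (by linarith [hx.1])

theorem continuousOn_rpow_div_one_add_pow {s : ℝ} (hs : 0 ≤ s) (n : ℕ) :
    ContinuousOn (fun x : ℝ => x ^ s / (1 + x) ^ n) (Icc 0 1) := by
  simpa only [div_eq_mul_inv] using!
    (Real.continuous_rpow_const hs).continuousOn.mul (continuousOn_inv_one_add_pow n)

theorem intervalIntegrable_rpow_div_one_add_pow {s : ℝ} (hs : -1 < s) (n : ℕ) :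
    IntervalIntegrable (fun x : ℝ => x ^ s / (1 + x) ^ n) volume 0 1 := by
  simpa only [div_eq_mul_inv] using (intervalIntegrable_rpow' hs).mul_continuousOn
    (by simpa only [uIcc_of_le zero_le_one] using continuousOn_inv_one_add_pow n)

theorem intervalIntegrable_rpow_div_one_add {s : ℝ} (hs : -1 < s) :
    IntervalIntegrable (fun x : ℝ => x ^ s / (1 + x)) volume 0 1 := by
  simpa only [pow_one] using intervalIntegrable_rpow_div_one_add_pow hs 1

/-- Substitution y = x^s. For s < 1 the factor s x^(s-1) is unbounded at 0, so the form of the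
substitution rule used needs the derivative only on the open interval, plus integrability. -/
theorem xi0_eq_recipHypergeometric {s : ℝ} (hs : 0 < s) :
    xi0 s = 2 * recipHypergeometric s⁻¹ - 1 := by
  have himage : (fun x : ℝ => x ^ s) '' uIcc 0 1 ⊆ Icc 0 1 := by
    rw [uIcc_of_le zero_le_one]
    rintro _ ⟨x, hx, rfl⟩
    exact ⟨Real.rpow_nonneg hx.1 s, Real.rpow_le_one hx.1 hx.2 hs.le⟩
  have hg : ContinuousOn (fun y : ℝ => (1 + y ^ s⁻¹)⁻¹) (Icc 0 1) := by
    refine ContinuousOn.inv₀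
      (continuous_const.add (Real.continuous_rpow_const (inv_nonneg.2 hs.le))).continuousOn ?_
    intro y hy
    have := Real.rpow_nonneg hy.1 s⁻¹
    positivity
  have hcongr : ∀ x ∈ Icc (0 : ℝ) 1, s * (x ^ (s - 1) / (1 + x)) =
      ((fun y : ℝ => (1 + y ^ s⁻¹)⁻¹) ∘ fun x => x ^ s) x * (s * x ^ (s - 1)) := by
    intro x hx
    simp only [Function.comp_apply, Real.rpow_rpow_inv hx.1 hs.ne']
    ring
  have hsub := integral_comp_mul_deriv''' (a := 0) (b := 1) (f := fun x : ℝ => x ^ s)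
    (f' := fun x => s * x ^ (s - 1)) (g := fun y : ℝ => (1 + y ^ s⁻¹)⁻¹)
    (Real.continuous_rpow_const hs.le).continuousOn
    (fun x hx => by
      rw [min_eq_left zero_le_one] at hx
      exact (Real.hasDerivAt_rpow_const (Or.inl hx.1.ne')).hasDerivWithinAt)
    (hg.mono ((image_mono (by
      rw [uIcc_of_le zero_le_one, min_eq_left zero_le_one, max_eq_right zero_le_one]
      exact Ioo_subset_Icc_self)).trans himage))
    ((hg.integrableOn_Icc).mono_set himage)
    (by
      rw [uIcc_of_le zero_le_one]
      refine IntegrableOn.congr_fun ?_ hcongr measurableSet_Icc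
      exact (intervalIntegrable_iff_integrableOn_Icc_of_le zero_le_one).1
        ((intervalIntegrable_rpow_div_one_add (by linarith)).const_mul s))
  simp only [Real.zero_rpow hs.ne', Real.one_rpow] at hsub
  rw [xi0_eq_integral hs, recipHypergeometric, ← hsub, ← intervalIntegral.integral_const_mul]
  congr 2
  refine integral_congr fun x hx => hcongr x ?_
  rwa [uIcc_of_le zero_le_one] at hx

/-- Comes from x^(s-1)/(1 + x) + x^s/(1 + x) = x^(s-1), whose integral is 1/s. -/
theorem xi1_eq_integral {s : ℝ} (hs : 0 < s) :
    xi1 s = ∫ x in (0 : ℝ)..1, x ^ s / (1 + x) := by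
  have hadd : (∫ x in (0 : ℝ)..1, x ^ (s - 1) / (1 + x)) + ∫ x in (0 : ℝ)..1, x ^ s / (1 + x) =
      1 / s := by
    rw [← intervalIntegral.integral_add (intervalIntegrable_rpow_div_one_add (by linarith))
      (intervalIntegrable_rpow_div_one_add (by linarith))]
    have hpow : ∫ x in (0 : ℝ)..1, x ^ (s - 1) = 1 / s := by
      rw [integral_rpow (Or.inl (by linarith)), sub_add_cancel, Real.one_rpow,
        Real.zero_rpow hs.ne', sub_zero]
    rw [← hpow]
    refine integral_congr_ae (Eventually.of_forall fun x hx => ?_)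
    rw [uIoc_of_le zero_le_one] at hx
    have h1 : 1 + x ≠ 0 := by linarith [hx.1]
    have h2 : x ^ s = x ^ (s - 1) * x := by
      rw [← Real.rpow_add_one hx.1.ne', sub_add_cancel]
    rw [h2]
    field_simp
  rw [xi1, xi0_eq_integral hs, eq_sub_of_add_eq hadd]
  field_simp
  ring

/-- Integration by parts: the boundary term of x^s/(1 + x) is 1/2, which cancels the -1 in ξ₀. -/
theorem xi0_eq_integral_sq {s : ℝ} (hs : 0 < s) :
    xi0 s = 2 * ∫ x in (0 : ℝ)..1, x ^ s / (1 + x) ^ 2 := by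
  have h1 := (intervalIntegrable_rpow_div_one_add (s := s - 1) (by linarith)).const_mul s
  have h2 := intervalIntegrable_rpow_div_one_add_pow (s := s) (by linarith) 2
  have hparts := integral_eq_sub_of_hasDerivAt_of_le zero_le_one
    (f := fun x : ℝ => x ^ s / (1 + x))
    (f' := fun x => s * (x ^ (s - 1) / (1 + x)) - x ^ s / (1 + x) ^ 2)
    (by simpa only [pow_one] using continuousOn_rpow_div_one_add_pow hs.le 1)
    (fun x hx => by
      have hx1 : 1 + x ≠ 0 := by linarith [hx.1]
      convert! (Real.hasDerivAt_rpow_const (p := s) (Or.inl hx.1.ne')).div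
        ((hasDerivAt_id x).const_add 1) hx1 using 1
      simp only [id]
      field_simp) (h1.sub h2)
  rw [intervalIntegral.integral_sub h1 h2, intervalIntegral.integral_const_mul, Real.one_rpow,
    Real.zero_rpow hs.ne'] at hparts
  rw [xi0_eq_integral hs]
  linarith

/-! ### Monotonicity and continuity -/

theorem xi3_eq_div {s : ℝ} : xi3 s = xi1 s / xi0 s := by
  rw [xi3, xi1, div_div]

theorem xi0_pos {s : ℝ} (hs : 0 < s) : 0 < xi0 s := by
  have := strictMono_recipHypergeometric (inv_pos.2 hs)
  rw [recipHypergeometric_zero] at this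
  rw [xi0_eq_recipHypergeometric hs]
  linarith

theorem hasDerivAt_xi0 {s : ℝ} (hs : 0 < s) :
    HasDerivAt xi0 (-(2 * recipHypergeometricDeriv s⁻¹) / s ^ 2) s := by
  have h := (((hasDerivAt_recipHypergeometric s⁻¹).comp s (hasDerivAt_inv hs.ne')).const_mul
    2).sub_const 1
  refine (h.congr_of_eventuallyEq ?_).congr_deriv (by ring)
  filter_upwards [Ioi_mem_nhds hs] with t ht using xi0_eq_recipHypergeometric ht

theorem continuousOn_xi0 : ContinuousOn xi0 (Ioi 0) := fun _ hs =>
  (hasDerivAt_xi0 hs).continuousAt.continuousWithinAt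

theorem strictAntiOn_xi0 : StrictAntiOn xi0 (Ioi 0) := by
  intro s hs t ht hst
  rw [xi0_eq_recipHypergeometric hs, xi0_eq_recipHypergeometric ht]
  linarith [strictMono_recipHypergeometric (inv_strictAnti₀ hs hst)]

theorem strictAntiOn_sq_mul_deriv_xi0 :
    StrictAntiOn (fun s : ℝ => s ^ 2 * deriv xi0 s) (Ioi 0) := by
  have h : ∀ s ∈ Ioi (0 : ℝ), s ^ 2 * deriv xi0 s = -(2 * recipHypergeometricDeriv s⁻¹) := by
    intro s hs
    have : s ≠ 0 := (mem_Ioi.1 hs).ne'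
    rw [(hasDerivAt_xi0 hs).deriv]
    field_simp
  intro s hs t ht hst
  simp only [h s hs, h t ht]
  linarith [strictAntiOn_recipHypergeometricDeriv (mem_Ici.2 (inv_nonneg.2 (le_of_lt ht)))
    (mem_Ici.2 (inv_nonneg.2 (le_of_lt hs))) (inv_strictAnti₀ hs hst)]

theorem strictAntiOn_xi1 : StrictAntiOn xi1 (Ioi 0) := by
  intro s (hs : 0 < s) t (ht : 0 < t) hst
  rw [xi1_eq_integral hs, xi1_eq_integral ht]
  refine intervalIntegral_lt_of_forall_Ioo_lt (intervalIntegrable_rpow_div_one_add (by linarith))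
    (intervalIntegrable_rpow_div_one_add (by linarith)) one_pos fun x hx => ?_
  exact div_lt_div_of_pos_right (Real.rpow_lt_rpow_of_exponent_gt hx.1 hx.2 hst)
    (by linarith [hx.1])

/-- The -1 in ξ₀ is -2H(0). The term s⁻¹ - 0 is kept to match the secant and slope lemmas. -/
theorem xi2_eq_slope {s : ℝ} (hs : 0 < s) :
    xi2 s = 4 * ((recipHypergeometric s⁻¹ - recipHypergeometric 0) / (s⁻¹ - 0)) := by
  rw [xi2, xi0_eq_recipHypergeometric hs, recipHypergeometric_zero]
  field_simp
  ring

theorem strictMonoOn_xi2 : StrictMonoOn xi2 (Ioi 0) := by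
  intro s hs t ht hst
  have hs' : 0 < s⁻¹ := inv_pos.2 hs
  have ht' : 0 < t⁻¹ := inv_pos.2 ht
  rw [xi2_eq_slope hs, xi2_eq_slope ht]
  linarith [strictConcaveOn_recipHypergeometric.secant_strict_mono (a := 0) self_mem_Ici
    ht'.le hs'.le ht'.ne' hs'.ne' (inv_strictAnti₀ hs hst)]

/-- A Chebyshev-type argument: B/A is the mean of 1 + x for the weight x^u/(1 + x)², and passing
from s to t multiplies the weight by the increasing function x^(t-s). -/
theorem strictMonoOn_xi3 : StrictMonoOn xi3 (Ioi 0) := by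
  intro s (hs : 0 < s) t (ht : 0 < t) hst
  set A : ℝ → ℝ := fun u => ∫ x in (0 : ℝ)..1, x ^ u / (1 + x) ^ 2 with hA
  set B : ℝ → ℝ := fun u => ∫ x in (0 : ℝ)..1, x ^ u / (1 + x) with hB
  have hA0 (u : ℝ) (hu : 0 < u) : xi0 u = 2 * A u := xi0_eq_integral_sq hu
  have hB1 (u : ℝ) (hu : 0 < u) : xi1 u = B u := xi1_eq_integral hu
  have hApos (u : ℝ) (hu : 0 < u) : 0 < A u := by linarith [xi0_pos hu, hA0 u hu]
  have hAB : A s < B s := by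
    refine intervalIntegral_lt_of_forall_Ioo_lt
      (intervalIntegrable_rpow_div_one_add_pow (by linarith) 2)
      (intervalIntegrable_rpow_div_one_add (by linarith)) one_pos fun x hx => ?_
    have := Real.rpow_pos_of_pos hx.1 s
    exact div_lt_div_of_pos_left this (by linarith [hx.1]) (by nlinarith [hx.1])
  -- c is the mean of x for the weight x^s/(1 + x)², so x - c has weighted integral zero at exponent
  -- s.
  obtain ⟨c, hc⟩ : ∃ c, B s / A s = 1 + c := ⟨B s / A s - 1, by ring⟩
  have hc0 : 0 < c := by
    have := (one_lt_div (hApos s hs)).2 hAB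
    linarith
  have hlin (u : ℝ) (hu : 0 < u) :
      ∫ x in (0 : ℝ)..1, (x - c) * (x ^ u / (1 + x) ^ 2) = B u - (1 + c) * A u := by
    rw [hA, hB, ← intervalIntegral.integral_const_mul, ← intervalIntegral.integral_sub
      (intervalIntegrable_rpow_div_one_add (by linarith))
      ((intervalIntegrable_rpow_div_one_add_pow (by linarith) 2).const_mul _)]
    refine integral_congr fun x hx => ?_
    rw [uIcc_of_le zero_le_one] at hx
    have : 1 + x ≠ 0 := by linarith [hx.1]
    field_simp
    ring
  have hcont (u : ℝ) (hu : 0 < u) :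
      ContinuousOn (fun x : ℝ => (x - c) * (x ^ u / (1 + x) ^ 2)) (Icc 0 1) :=
    (by fun_prop : ContinuousOn (fun x : ℝ => x - c) (Icc 0 1)).mul
      (continuousOn_rpow_div_one_add_pow hu.le 2)
  have hd : 0 < t - s := by linarith
  -- Subtracting c^(t-s) times the exponent-s integrand costs nothing after integration and leaves
  -- (x - c)(x^(t-s) - c^(t-s)), whose factors have the same sign.
  have hfac : ∀ x ∈ Ioc (0 : ℝ) 1, (x - c) * (x ^ t / (1 + x) ^ 2) -
      c ^ (t - s) * ((x - c) * (x ^ s / (1 + x) ^ 2)) =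
      (x - c) * (x ^ (t - s) - c ^ (t - s)) * (x ^ s / (1 + x) ^ 2) := by
    intro x hx
    have : x ^ t = x ^ (t - s) * x ^ s := by rw [← Real.rpow_add hx.1, sub_add_cancel]
    rw [this]
    ring
  have hpos : ∀ x ∈ Ioc (0 : ℝ) 1, x ≠ c →
      0 < (x - c) * (x ^ (t - s) - c ^ (t - s)) * (x ^ s / (1 + x) ^ 2) := by
    intro x hx hxc
    have hxs := Real.rpow_pos_of_pos hx.1 s
    have hx1 : 0 < 1 + x := by linarith [hx.1]
    refine mul_pos ?_ (by positivity)
    rcases lt_or_gt_of_ne hxc with h | h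
    · exact mul_pos_of_neg_of_neg (sub_neg.2 h) (sub_neg.2 (Real.rpow_lt_rpow hx.1.le h hd))
    · exact mul_pos (sub_pos.2 h) (sub_pos.2 (Real.rpow_lt_rpow hc0.le h hd))
  have hlt := integral_lt_integral_of_continuousOn_of_le_of_exists_lt one_pos
    ((hcont s hs).const_mul (c ^ (t - s))) (hcont t ht)
    (fun x hx => by
      rw [← sub_nonneg, hfac x hx]
      rcases eq_or_ne x c with rfl | h
      · simp
      · exact (hpos x hx h).le)
    (by
      -- Strictness at one point x ≠ c suffices by continuity; c < 1 was not established, so c = 1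
      -- gets its own witness.
      obtain ⟨x, hx, hxc⟩ : ∃ x ∈ Ioc (0 : ℝ) 1, x ≠ c := by
        rcases eq_or_ne 1 c with h | h
        · exact ⟨1 / 2, by norm_num, by rw [← h]; norm_num⟩
        · exact ⟨1, by norm_num, h⟩
      refine ⟨x, Ioc_subset_Icc_self hx, ?_⟩
      rw [← sub_pos, hfac x hx]
      exact hpos x hx hxc)
  have hs0 : B s - (1 + c) * A s = 0 := by
    rw [← hc, div_mul_cancel₀ _ (hApos s hs).ne', sub_self]
  rw [intervalIntegral.integral_const_mul, hlin s hs, hlin t ht, hs0, mul_zero] at hlt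
  have hfin : B s / A s < B t / A t := by
    rw [hc, lt_div_iff₀ (hApos t ht)]
    linarith
  rw [xi3_eq_div, xi3_eq_div, hA0 s hs, hA0 t ht, hB1 s hs, hB1 t ht, mul_comm 2, mul_comm 2,
    ← div_div, ← div_div]
  linarith

theorem continuousOn_xi1 : ContinuousOn xi1 (Ioi 0) :=
  (continuousOn_const.sub continuousOn_xi0).div (by fun_prop) fun s hs => by
    have : 0 < s := hs
    positivity

theorem continuousOn_xi2 : ContinuousOn xi2 (Ioi 0) :=
  (by fun_prop : ContinuousOn (fun s : ℝ => 2 * s) (Ioi 0)).mul continuousOn_xi0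

theorem continuousOn_xi3 : ContinuousOn xi3 (Ioi 0) :=
  (continuousOn_xi1.div continuousOn_xi0 fun _ hs => (xi0_pos hs).ne').congr fun _ _ => xi3_eq_div

/-! ### Limits at 0 and at ∞ -/

theorem tendsto_xi1_zero : Tendsto xi1 (𝓝[>] 0) (𝓝 (Real.log 2)) := by
  have hlog : ∫ x in (0 : ℝ)..1, 1 / (1 + x) = Real.log 2 := by
    rw [integral_comp_add_left (fun x : ℝ => 1 / x) 1, integral_one_div_of_pos] <;> norm_num
  rw [← hlog]
  have h : Tendsto (fun s : ℝ => ∫ x in (0 : ℝ)..1, x ^ s / (1 + x)) (𝓝[>] 0)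
      (𝓝 (∫ x in (0 : ℝ)..1, 1 / (1 + x))) := by
    refine tendsto_integral_filter_of_dominated_convergence (fun _ => 1) ?_ ?_
      intervalIntegrable_const ?_
    · exact Eventually.of_forall fun s =>
        (by fun_prop : Measurable fun x : ℝ => x ^ s / (1 + x)).aestronglyMeasurable
    · filter_upwards [self_mem_nhdsWithin] with s hs
      refine Eventually.of_forall fun x hx => ?_
      rw [uIoc_of_le zero_le_one] at hx
      have h0 := Real.rpow_nonneg hx.1.le s
      have h1 := Real.rpow_le_one hx.1.le hx.2 (le_of_lt hs)
      have hx1 : 0 < 1 + x := by linarith [hx.1]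
      rw [Real.norm_of_nonneg (by positivity), div_le_one hx1]
      linarith [hx.1]
    · refine Eventually.of_forall fun x hx => ?_
      rw [uIoc_of_le zero_le_one] at hx
      have := ((Real.continuous_const_rpow hx.1.ne').tendsto 0).mono_left
        (nhdsWithin_le_nhds (s := Ioi 0))
      rw [Real.rpow_zero] at this
      exact this.div_const _
  refine h.congr' ?_
  filter_upwards [self_mem_nhdsWithin] with s hs using (xi1_eq_integral hs).symm

theorem tendsto_two_mul_nhdsGT_zero : Tendsto (fun s : ℝ => 2 * s) (𝓝[>] 0) (𝓝 0) :=
  tendsto_nhdsWithin_of_tendsto_nhds (Continuous.tendsto' (by fun_prop) _ _ (mul_zero 2))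

/-- Read off from ξ₀ = 1 - 2sξ₁ with ξ₁ convergent, which avoids studying H at ∞. -/
theorem tendsto_xi0_zero : Tendsto xi0 (𝓝[>] 0) (𝓝 1) := by
  have h := (tendsto_two_mul_nhdsGT_zero.mul tendsto_xi1_zero).const_sub 1
  rw [zero_mul, sub_zero] at h
  refine h.congr' ?_
  filter_upwards [self_mem_nhdsWithin] with s hs
  have : s ≠ 0 := (mem_Ioi.1 hs).ne'
  rw [xi1]
  field_simp
  ring

theorem tendsto_xi2_zero : Tendsto xi2 (𝓝[>] 0) (𝓝 0) := by
  simpa using! tendsto_two_mul_nhdsGT_zero.mul tendsto_xi0_zero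

theorem tendsto_xi3_zero : Tendsto xi3 (𝓝[>] 0) (𝓝 (Real.log 2)) := by
  have h := tendsto_xi1_zero.div tendsto_xi0_zero one_ne_zero
  rw [div_one] at h
  exact h.congr fun _ => xi3_eq_div.symm

theorem tendsto_xi0_atTop : Tendsto xi0 atTop (𝓝 0) := by
  have h := (((continuous_recipHypergeometric.tendsto 0).comp
    tendsto_inv_atTop_zero).const_mul 2).sub_const 1
  rw [recipHypergeometric_zero, mul_one_div_cancel two_ne_zero, sub_self] at h
  refine h.congr' ?_
  filter_upwards [Ioi_mem_atTop 0] with s hs using (xi0_eq_recipHypergeometric hs).symm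

theorem tendsto_xi1_atTop : Tendsto xi1 atTop (𝓝 0) :=
  (tendsto_xi0_atTop.const_sub 1).div_atTop (tendsto_id.const_mul_atTop two_pos)

/-- As 1/s → 0⁺ the secant slope tends to H'(0) = 1/4. -/
theorem tendsto_xi2_atTop : Tendsto xi2 atTop (𝓝 1) := by
  have hslope := (hasDerivAt_iff_tendsto_slope.1 (hasDerivAt_recipHypergeometric 0)).comp
    (tendsto_inv_atTop_nhdsGT_zero.mono_right (nhdsWithin_mono _ fun w hw => ne_of_gt hw))
  have h := hslope.const_mul 4
  rw [recipHypergeometricDeriv_zero, mul_one_div_cancel four_ne_zero] at h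
  refine h.congr' ?_
  filter_upwards [Ioi_mem_atTop 0] with s hs
  rw [Function.comp_apply, slope_def_field, xi2_eq_slope hs]

theorem tendsto_xi3_atTop : Tendsto xi3 atTop (𝓝 1) := by
  simpa using! (tendsto_xi0_atTop.const_sub 1).div tendsto_xi2_atTop one_ne_zero

theorem theorem2p3 :
    -- continuity on (0, ∞)
    (ContinuousOn xi0 (Ioi 0) ∧ ContinuousOn xi1 (Ioi 0) ∧
      ContinuousOn xi2 (Ioi 0) ∧ ContinuousOn xi3 (Ioi 0)) ∧
    -- ξ₀
    (StrictAntiOn xi0 (Ioi 0) ∧ xi0 '' Ioi 0 = Ioo 0 1 ∧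
      DifferentiableOn ℝ xi0 (Ioi 0) ∧
      StrictAntiOn (fun s : ℝ => s ^ 2 * deriv xi0 s) (Ioi 0)) ∧
    -- ξ₁
    (StrictAntiOn xi1 (Ioi 0) ∧ xi1 '' Ioi 0 = Ioo 0 (Real.log 2)) ∧
    -- ξ₂
    (StrictMonoOn xi2 (Ioi 0) ∧ xi2 '' Ioi 0 = Ioo 0 1) ∧
    -- ξ₃
    (StrictMonoOn xi3 (Ioi 0) ∧ xi3 '' Ioi 0 = Ioo (Real.log 2) 1) ∧
    -- the continuous extensions to 0 and to ∞
    (Tendsto xi0 (𝓝[>] 0) (𝓝 1) ∧ Tendsto xi0 atTop (𝓝 0)) ∧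
    (Tendsto xi1 (𝓝[>] 0) (𝓝 (Real.log 2)) ∧ Tendsto xi1 atTop (𝓝 0)) ∧
    (Tendsto xi2 (𝓝[>] 0) (𝓝 0) ∧ Tendsto xi2 atTop (𝓝 1)) ∧
    (Tendsto xi3 (𝓝[>] 0) (𝓝 (Real.log 2)) ∧ Tendsto xi3 atTop (𝓝 1)) :=
  ⟨⟨continuousOn_xi0, continuousOn_xi1, continuousOn_xi2, continuousOn_xi3⟩,
    ⟨strictAntiOn_xi0, strictAntiOn_xi0.image_Ioi_eq_Ioo continuousOn_xi0 tendsto_xi0_zero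
      tendsto_xi0_atTop,
      fun _ hs => (hasDerivAt_xi0 hs).differentiableAt.differentiableWithinAt,
      strictAntiOn_sq_mul_deriv_xi0⟩,
    ⟨strictAntiOn_xi1, strictAntiOn_xi1.image_Ioi_eq_Ioo continuousOn_xi1 tendsto_xi1_zero
      tendsto_xi1_atTop⟩,
    ⟨strictMonoOn_xi2, strictMonoOn_xi2.image_Ioi_eq_Ioo continuousOn_xi2 tendsto_xi2_zero
      tendsto_xi2_atTop⟩,
    ⟨strictMonoOn_xi3, strictMonoOn_xi3.image_Ioi_eq_Ioo continuousOn_xi3 tendsto_xi3_zero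
      tendsto_xi3_atTop⟩,
    ⟨tendsto_xi0_zero, tendsto_xi0_atTop⟩, ⟨tendsto_xi1_zero, tendsto_xi1_atTop⟩,
    ⟨tendsto_xi2_zero, tendsto_xi2_atTop⟩, ⟨tendsto_xi3_zero, tendsto_xi3_atTop⟩⟩
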